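/- Let $K$ be a field of characteristic zero with a real valuation $|\cdot| : K\to\mathbb R_{\ge 0}$, i.e. $|a|=0\Leftrightarrow a=0$, $|ab|=|a||b|$ and $|a+b|\le|a|+|b|$ (the trivial valuation is allowed, and $K$ need not be complete). Let $K\{x\}=K\{x_1,\dots,x_n\}$ be the ring of convergent power series, that is, of those $f=\sum_{\alpha\in\mathbb N^n} c_\alpha x^\alpha\in K[[x_1,\dots,x_n]]$ for which there is $\varepsilon\in(\mathbb R_{>0})^n$ with $\sum_\alpha |c_\alpha|\,\varepsilon^\alpha<\infty$, and let $\mathfrak m=\langle x_1,\dots,x_n\rangle\subset K\{x\}$. For $f\in K\{x\}$ define the Milnor number and the Tjurina number $$\mu(f)=\dim_K K\{x\}\big/\big\langle \tfrac{\partial f}{\partial x_1},\dots,\tfrac{\partial f}{\partial x_n}\big\rangle,\qquad \tau(f)=\dim_K K\{x\}\big/\big\langle f,\tfrac{\partial f}{\partial x_1},\dots,\tfrac{\partial f}{\partial x_n}\big\rangle,$$ with values in $\mathbb N\cup\{\infty\}$. Then for every $f\in\mathfrak m$: $\mu(f)<\infty$ if and only if $\tau(f)<\infty$. -/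

import Mathlib

open scoped ENNReal

namespace AnalyticSeries

/-- The weighted norm `‖f‖_ε = ∑_α |c_α| ε^α ∈ [0, ∞]` of a formal power series
`f = ∑_α c_α x^α` in `n` variables over a field `K` with absolute value `v = | |`. -/
noncomputable def wnorm {K : Type*} [Field K] (v : AbsoluteValue K ℝ) {n : ℕ}
    (ε : Fin n → ℝ) (f : MvPowerSeries (Fin n) K) : ℝ≥0∞ :=
  ∑' α : Fin n →₀ ℕ, ENNReal.ofReal (v (MvPowerSeries.coeff α f) * ∏ i, ε i ^ α i)

/-- `f` is convergent if `‖f‖_ε < ∞` for some vector `ε` of positive real numbers. -/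
def IsConvergent {K : Type*} [Field K] (v : AbsoluteValue K ℝ) {n : ℕ}
    (f : MvPowerSeries (Fin n) K) : Prop :=
  ∃ ε : Fin n → ℝ, (∀ i, 0 < ε i) ∧ wnorm v ε f < ∞

theorem wnorm_mono {K : Type*} [Field K] (v : AbsoluteValue K ℝ) {n : ℕ} {ε δ : Fin n → ℝ}
    (hε : ∀ i, 0 < ε i) (h : ∀ i, ε i ≤ δ i) (f : MvPowerSeries (Fin n) K) :
    wnorm v ε f ≤ wnorm v δ f := by
  refine ENNReal.tsum_le_tsum fun α => ENNReal.ofReal_le_ofReal ?_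
  refine mul_le_mul_of_nonneg_left ?_ (v.nonneg _)
  exact Finset.prod_le_prod (fun i _ => pow_nonneg (hε i).le _)
    (fun i _ => pow_le_pow_left₀ (hε i).le (h i) _)

theorem wnorm_add_le {K : Type*} [Field K] (v : AbsoluteValue K ℝ) {n : ℕ} {ε : Fin n → ℝ}
    (hε : ∀ i, 0 < ε i) (f g : MvPowerSeries (Fin n) K) :
    wnorm v ε (f + g) ≤ wnorm v ε f + wnorm v ε g := by
  unfold wnorm
  rw [← ENNReal.tsum_add]
  refine ENNReal.tsum_le_tsum fun α => ?_
  have hp : 0 ≤ ∏ i, ε i ^ α i := Finset.prod_nonneg fun i _ => pow_nonneg (hε i).le _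
  rw [← ENNReal.ofReal_add (mul_nonneg (v.nonneg _) hp) (mul_nonneg (v.nonneg _) hp), ← add_mul]
  refine ENNReal.ofReal_le_ofReal (mul_le_mul_of_nonneg_right ?_ hp)
  rw [map_add]
  exact v.add_le _ _

theorem wnorm_mul_le {K : Type*} [Field K] (v : AbsoluteValue K ℝ) {n : ℕ} {ε : Fin n → ℝ}
    (hε : ∀ i, 0 < ε i) (f g : MvPowerSeries (Fin n) K) :
    wnorm v ε (f * g) ≤ wnorm v ε f * wnorm v ε g := by
  classical
  have hp : ∀ α : Fin n →₀ ℕ, 0 ≤ ∏ i, ε i ^ α i := fun α =>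
    Finset.prod_nonneg fun i _ => pow_nonneg (hε i).le _
  set F : (Fin n →₀ ℕ) → ℝ≥0∞ := fun α =>
    ENNReal.ofReal (v (MvPowerSeries.coeff α f) * ∏ i, ε i ^ α i) with hF
  set G : (Fin n →₀ ℕ) → ℝ≥0∞ := fun α =>
    ENNReal.ofReal (v (MvPowerSeries.coeff α g) * ∏ i, ε i ^ α i) with hG
  have key : ∀ α : Fin n →₀ ℕ,
      ENNReal.ofReal (v (MvPowerSeries.coeff α (f * g)) * ∏ i, ε i ^ α i) ≤
        ∑' p : Finset.HasAntidiagonal.antidiagonal α, F p.1.1 * G p.1.2 := by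
    intro α
    rw [Finset.tsum_subtype (Finset.HasAntidiagonal.antidiagonal α) (fun p => F p.1 * G p.2)]
    have hle : v (MvPowerSeries.coeff α (f * g)) * ∏ i, ε i ^ α i ≤
        ∑ p ∈ Finset.HasAntidiagonal.antidiagonal α,
          (v (MvPowerSeries.coeff p.1 f) * ∏ i, ε i ^ p.1 i) *
            (v (MvPowerSeries.coeff p.2 g) * ∏ i, ε i ^ p.2 i) := by
      rw [MvPowerSeries.coeff_mul]
      refine (mul_le_mul_of_nonneg_right (v.sum_le _ _) (hp α)).trans ?_
      rw [Finset.sum_mul]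
      refine Finset.sum_le_sum fun p hpα => le_of_eq ?_
      rw [← Finset.HasAntidiagonal.mem_antidiagonal.mp hpα, v.map_mul]
      have : ∏ i, ε i ^ (p.1 + p.2) i = (∏ i, ε i ^ p.1 i) * ∏ i, ε i ^ p.2 i := by
        rw [← Finset.prod_mul_distrib]
        exact Finset.prod_congr rfl fun i _ => by rw [Finsupp.add_apply, pow_add]
      rw [this]
      ring
    refine (ENNReal.ofReal_le_ofReal hle).trans ?_
    rw [ENNReal.ofReal_sum_of_nonneg fun p _ => mul_nonneg
      (mul_nonneg (v.nonneg _) (hp _)) (mul_nonneg (v.nonneg _) (hp _))]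
    refine Finset.sum_le_sum fun p _ => le_of_eq ?_
    rw [ENNReal.ofReal_mul (mul_nonneg (v.nonneg _) (hp _))]
  calc wnorm v ε (f * g)
      ≤ ∑' α : Fin n →₀ ℕ, ∑' p : Finset.HasAntidiagonal.antidiagonal α, F p.1.1 * G p.1.2 :=
        ENNReal.tsum_le_tsum key
    _ = ∑' q : (Σ α : Fin n →₀ ℕ, Finset.HasAntidiagonal.antidiagonal α), F q.2.1.1 * G q.2.1.2 :=
        (ENNReal.tsum_sigma' (fun q : (Σ α : Fin n →₀ ℕ, Finset.HasAntidiagonal.antidiagonal α) =>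
          F q.2.1.1 * G q.2.1.2)).symm
    _ = ∑' p : (Fin n →₀ ℕ) × (Fin n →₀ ℕ), F p.1 * G p.2 :=
        Finset.HasAntidiagonal.sigmaAntidiagonalEquivProd.tsum_eq
          (fun p : (Fin n →₀ ℕ) × (Fin n →₀ ℕ) => F p.1 * G p.2)
    _ = ∑' α, ∑' β, F α * G β := ENNReal.tsum_prod (f := fun α β => F α * G β)
    _ = wnorm v ε f * wnorm v ε g := by
        simp_rw [ENNReal.tsum_mul_left, ENNReal.tsum_mul_right]
        rfl

theorem IsConvergent.common {K : Type*} [Field K] {v : AbsoluteValue K ℝ} {n : ℕ}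
    {f g : MvPowerSeries (Fin n) K} (hf : IsConvergent v f) (hg : IsConvergent v g) :
    ∃ ε : Fin n → ℝ, (∀ i, 0 < ε i) ∧ wnorm v ε f < ∞ ∧ wnorm v ε g < ∞ := by
  obtain ⟨ε, hε, hf⟩ := hf
  obtain ⟨δ, hδ, hg⟩ := hg
  have h : ∀ i, 0 < min (ε i) (δ i) := fun i => lt_min (hε i) (hδ i)
  exact ⟨fun i => min (ε i) (δ i), h,
    (wnorm_mono v h (fun i => min_le_left _ _) f).trans_lt hf,
    (wnorm_mono v h (fun i => min_le_right _ _) g).trans_lt hg⟩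

theorem IsConvergent.add {K : Type*} [Field K] {v : AbsoluteValue K ℝ} {n : ℕ}
    {f g : MvPowerSeries (Fin n) K} (hf : IsConvergent v f) (hg : IsConvergent v g) :
    IsConvergent v (f + g) := by
  obtain ⟨ε, hε, hf, hg⟩ := hf.common hg
  exact ⟨ε, hε, (wnorm_add_le v hε f g).trans_lt (ENNReal.add_lt_top.mpr ⟨hf, hg⟩)⟩

theorem IsConvergent.mul {K : Type*} [Field K] {v : AbsoluteValue K ℝ} {n : ℕ}
    {f g : MvPowerSeries (Fin n) K} (hf : IsConvergent v f) (hg : IsConvergent v g) :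
    IsConvergent v (f * g) := by
  obtain ⟨ε, hε, hf, hg⟩ := hf.common hg
  exact ⟨ε, hε, (wnorm_mul_le v hε f g).trans_lt (ENNReal.mul_lt_top hf hg)⟩

theorem isConvergent_monomial {K : Type*} [Field K] (v : AbsoluteValue K ℝ) {n : ℕ}
    (β : Fin n →₀ ℕ) (c : K) : IsConvergent v (MvPowerSeries.monomial β c) := by
  classical
  refine ⟨fun _ => 1, fun _ => one_pos, ?_⟩
  unfold wnorm
  rw [tsum_eq_single β]
  · exact ENNReal.ofReal_lt_top
  · intro α hα
    rw [MvPowerSeries.coeff_monomial_ne hα, v.map_zero, zero_mul, ENNReal.ofReal_zero]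

theorem IsConvergent.pderiv {K : Type*} [Field K] {v : AbsoluteValue K ℝ} {n : ℕ}
    {f : MvPowerSeries (Fin n) K} (hf : IsConvergent v f) (i : Fin n) :
    IsConvergent v (MvPowerSeries.pderiv K i f) := by
  classical
  obtain ⟨ε, hε, hf⟩ := hf
  refine ⟨fun j => ε j / 2, fun j => half_pos (hε j), ?_⟩
  have hp : ∀ α : Fin n →₀ ℕ, 0 ≤ ∏ j, ε j ^ α j := fun α =>
    Finset.prod_nonneg fun j _ => pow_nonneg (hε j).le _
  have hnat : ∀ m : ℕ, v (m : K) ≤ m := by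
    intro m
    induction m with
    | zero => simp
    | succ m ih =>
      push_cast
      exact (v.add_le _ _).trans (by rw [v.map_one]; linarith)
  have hpow : ∀ m : ℕ, (m : ℝ) + 1 ≤ 2 ^ m := by
    intro m
    exact_mod_cast Nat.lt_two_pow_self (n := m)
  have key : ∀ α : Fin n →₀ ℕ,
      v (MvPowerSeries.coeff α (MvPowerSeries.pderiv K i f)) * ∏ j, (ε j / 2) ^ α j ≤
        (ε i)⁻¹ * (v (MvPowerSeries.coeff (α + Finsupp.single i 1) f) *
          ∏ j, ε j ^ (α + Finsupp.single i 1 : Fin n →₀ ℕ) j) := by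
    intro α
    have h1 : ∏ j, ε j ^ (α + Finsupp.single i 1 : Fin n →₀ ℕ) j = ε i * ∏ j, ε j ^ α j := by
      have : ∀ j, ε j ^ (α + Finsupp.single i 1 : Fin n →₀ ℕ) j =
          (if j = i then ε i else 1) * ε j ^ α j := by
        intro j
        by_cases h : j = i
        · subst h; simp [pow_succ, mul_comm]
        · simp [h]
      simp_rw [this, Finset.prod_mul_distrib]
      simp
    have h2 : ∏ j, (ε j / 2) ^ α j = (∏ j, ε j ^ α j) / ∏ j, (2 : ℝ) ^ α j := by
      rw [← Finset.prod_div_distrib]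
      exact Finset.prod_congr rfl fun j _ => div_pow _ _ _
    have h3 : (α i : ℝ) + 1 ≤ ∏ j, (2 : ℝ) ^ α j := by
      refine (hpow (α i)).trans ?_
      rw [Finset.prod_pow_eq_pow_sum]
      exact pow_le_pow_right₀ one_le_two
        (Finset.single_le_sum (f := fun j => α j) (fun _ _ => Nat.zero_le _) (Finset.mem_univ i))
    have h4 : v ((α i : K) + 1) ≤ (α i : ℝ) + 1 := by
      have := hnat (α i + 1)
      push_cast at this
      exact this
    have h5 : (0 : ℝ) < ∏ j, (2 : ℝ) ^ α j := Finset.prod_pos fun j _ => by positivity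
    rw [MvPowerSeries.coeff_pderiv, v.map_mul, h1, h2]
    have hε' : ε i ≠ 0 := (hε i).ne'
    have h6 : v ((α i : K) + 1) / ∏ j, (2 : ℝ) ^ α j ≤ 1 :=
      (div_le_one h5).mpr (h4.trans h3)
    calc v (MvPowerSeries.coeff (α + Finsupp.single i 1) f) * v ((α i : K) + 1) *
          ((∏ j, ε j ^ α j) / ∏ j, (2 : ℝ) ^ α j)
        = (v (MvPowerSeries.coeff (α + Finsupp.single i 1) f) * ∏ j, ε j ^ α j) *
          (v ((α i : K) + 1) / ∏ j, (2 : ℝ) ^ α j) := by ring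
      _ ≤ (v (MvPowerSeries.coeff (α + Finsupp.single i 1) f) * ∏ j, ε j ^ α j) * 1 :=
          mul_le_mul_of_nonneg_left h6 (mul_nonneg (v.nonneg _) (hp α))
      _ = _ := by field_simp
  have hinj : Function.Injective
      fun α : Fin n →₀ ℕ => (α + Finsupp.single i 1 : Fin n →₀ ℕ) :=
    add_left_injective _
  calc wnorm v (fun j => ε j / 2) (MvPowerSeries.pderiv K i f)
      ≤ ∑' α : Fin n →₀ ℕ, ENNReal.ofReal (ε i)⁻¹ *
          ENNReal.ofReal (v (MvPowerSeries.coeff (α + Finsupp.single i 1) f) *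
            ∏ j, ε j ^ (α + Finsupp.single i 1 : Fin n →₀ ℕ) j) := by
        refine ENNReal.tsum_le_tsum fun α => ?_
        rw [← ENNReal.ofReal_mul (inv_nonneg.mpr (hε i).le)]
        exact ENNReal.ofReal_le_ofReal (key α)
    _ = ENNReal.ofReal (ε i)⁻¹ * ∑' α : Fin n →₀ ℕ,
          ENNReal.ofReal (v (MvPowerSeries.coeff (α + Finsupp.single i 1) f) *
            ∏ j, ε j ^ (α + Finsupp.single i 1 : Fin n →₀ ℕ) j) := ENNReal.tsum_mul_left
    _ ≤ ENNReal.ofReal (ε i)⁻¹ * wnorm v ε f := by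
        gcongr
        exact ENNReal.tsum_comp_le_tsum_of_injective hinj (fun α : Fin n →₀ ℕ =>
          ENNReal.ofReal (v (MvPowerSeries.coeff α f) * ∏ j, ε j ^ α j))
    _ < ∞ := ENNReal.mul_lt_top ENNReal.ofReal_lt_top hf

/-- The ring `K{x} = K{x₁, …, xₙ}` of convergent power series, as a `K`-subalgebra of
`K[[x₁, …, xₙ]]`. -/
def convSeries {K : Type*} [Field K] (v : AbsoluteValue K ℝ) (n : ℕ) :
    Subalgebra K (MvPowerSeries (Fin n) K) where
  carrier := {f | IsConvergent v f}
  mul_mem' := fun hf hg => hf.mul hg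
  add_mem' := fun hf hg => hf.add hg
  algebraMap_mem' := fun c => isConvergent_monomial v 0 c

/-- The variable `x_i` as an element of `K{x}`. -/
noncomputable def coord {K : Type*} [Field K] (v : AbsoluteValue K ℝ) {n : ℕ} (i : Fin n) :
    convSeries v n :=
  ⟨MvPowerSeries.X i, isConvergent_monomial v _ 1⟩

/-- The ideal `𝔪 = ⟨x₁, …, xₙ⟩` of `K{x}`. -/
noncomputable def maxIdeal {K : Type*} [Field K] (v : AbsoluteValue K ℝ) (n : ℕ) :
    Ideal (convSeries v n) :=
  Ideal.span (Set.range (coord v))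

/-- The partial derivative `∂f/∂x_i ∈ K{x}` of `f ∈ K{x}`. -/
noncomputable def partialDeriv {K : Type*} [Field K] {v : AbsoluteValue K ℝ} {n : ℕ}
    (i : Fin n) (f : convSeries v n) : convSeries v n :=
  ⟨MvPowerSeries.pderiv K i (f : MvPowerSeries (Fin n) K), IsConvergent.pderiv f.2 i⟩

/-- The Jacobian ideal `j(f) = ⟨∂f/∂x₁, …, ∂f/∂xₙ⟩ ⊆ K{x}`. -/
noncomputable def jacobianIdeal {K : Type*} [Field K] {v : AbsoluteValue K ℝ} {n : ℕ}
    (f : convSeries v n) : Ideal (convSeries v n) :=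
  Ideal.span (Set.range fun i => partialDeriv i f)

/-- The Tjurina ideal `tj(f) = ⟨f, ∂f/∂x₁, …, ∂f/∂xₙ⟩ ⊆ K{x}`. -/
noncomputable def tjurinaIdeal {K : Type*} [Field K] {v : AbsoluteValue K ℝ} {n : ℕ}
    (f : convSeries v n) : Ideal (convSeries v n) :=
  Ideal.span (insert f (Set.range fun i => partialDeriv i f))

/-- The Milnor number `μ(f) = dim_K K{x}/j(f) ∈ ℕ ∪ {∞}`. -/
noncomputable def milnorNumber {K : Type*} [Field K] {v : AbsoluteValue K ℝ} {n : ℕ}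
    (f : convSeries v n) : ℕ∞ :=
  Cardinal.toENat (Module.rank K (convSeries v n ⧸ jacobianIdeal f))

/-- The Tjurina number `τ(f) = dim_K K{x}/tj(f) ∈ ℕ ∪ {∞}`. -/
noncomputable def tjurinaNumber {K : Type*} [Field K] {v : AbsoluteValue K ℝ} {n : ℕ}
    (f : convSeries v n) : ℕ∞ :=
  Cardinal.toENat (Module.rank K (convSeries v n ⧸ tjurinaIdeal f))

end AnalyticSeries

/-! An ideal of `K{x}` has finite codimension exactly when it contains a power of `𝔪`. As `j(f) ⊆
tj(f)`, only the passage from `τ < ∞` to `μ < ∞` needs an argument.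

Its core is formal (`mem_of_isPrime_of_pderiv_mem`). Let `J` be the Jacobian ideal in `K⟦x⟧`, let
`𝔪^k ⊆ J + ⟨f⟩`, and suppose that a prime `P ⊇ J` does not contain `f`. Then `t ↦ f` makes `A =
K⟦x⟧/P` a finite extension of `K⟦t⟧`, and `d/dt` extends to `Frac A` because the extension of
fraction fields is separable in characteristic zero. The chain rule gives `1 = df/df = ∑ ∂f/∂xᵢ ·
dxᵢ/df = 0` in `Frac A`, a contradiction. So `f` lies in the radical of `J`, and `J` contains a
power of `𝔪`. The chain rule is clear for polynomials; it passes to power series by Krull's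
intersection theorem, because the derivative has bounded denominators on `A`.

The return to `K{x}` (`maxIdeal_pow_le_span_of_idealX_pow_le`) truncates formal coefficients to
polynomials and applies Nakayama's lemma. It needs only that division by the variables preserves
convergence and that `1 - g` is a unit if `g` has no constant term; neither completeness of `K` nor
Noetherianity of `K{x}` enters. -/

/-! ### Extending derivations and bounding their values -/

open TensorProduct in
-- Along a formally étale map `F ⊗ Ω[S⁄K] → Ω[F⁄K]` is an isomorphism, so the `F`-linear form
-- induced by `d` on the source is also one on the target.
theorem Derivation.exists_extension_of_formallyEtale {K S F : Type*} [CommRing K] [CommRing S]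
    [CommRing F] [Algebra K S] [Algebra K F] [Algebra S F] [IsScalarTower K S F]
    [Algebra.FormallyEtale S F] (d : Derivation K S S) :
    ∃ D : Derivation K F F, ∀ s, D (algebraMap S F s) = algebraMap S F (d s) := by
  let d' : Derivation K S F := (Algebra.linearMap S F).compDer d
  let ℓ : F ⊗[S] Ω[S⁄K] →ₗ[F] F := LinearMap.liftBaseChange F d'.liftKaehlerDifferential
  let e := KaehlerDifferential.tensorKaehlerEquivOfFormallyEtale K S F
  refine ⟨(ℓ ∘ₗ e.symm.toLinearMap).compDer (KaehlerDifferential.D K F), fun s => ?_⟩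
  have h : e.symm (KaehlerDifferential.D K F (algebraMap S F s)) =
      1 ⊗ₜ KaehlerDifferential.D K S s :=
    KaehlerDifferential.tensorKaehlerEquivOfFormallyEtale_symm_D_algebraMap K S F s
  change ℓ (e.symm (KaehlerDifferential.D K F (algebraMap S F s))) = _
  rw [h]
  simp [ℓ, d']

/-- The map factors through `FractionRing S`: a localization, followed by an algebraic field
extension that is separable by characteristic zero. -/
theorem formallyEtale_fractionRing_of_finite (S A : Type*) [CommRing S] [IsDomain S] [CharZero S]
    [CommRing A] [IsDomain A] [Algebra S A] [FaithfulSMul S A] [Module.Finite S A] :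
    Algebra.FormallyEtale S (FractionRing A) := by
  let := FractionRing.liftAlgebra S (FractionRing A)
  have : IsScalarTower S (FractionRing S) (FractionRing A) :=
    FractionRing.isScalarTower_liftAlgebra S (FractionRing A)
  have : CharZero (FractionRing S) :=
    charZero_of_injective_algebraMap (IsFractionRing.injective S (FractionRing S))
  have : Algebra.IsAlgebraic S (FractionRing A) :=
    (IsFractionRing.isAlgebraic_iff' S A (FractionRing A)).mp inferInstance
  have : Algebra.IsAlgebraic (FractionRing S) (FractionRing A) :=
    (IsFractionRing.comap_isAlgebraic_iff (A := S)).mp inferInstance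
  have : Algebra.FormallyEtale S (FractionRing S) :=
    Algebra.FormallyEtale.of_isLocalization (nonZeroDivisors S)
  have : Algebra.FormallyEtale (FractionRing S) (FractionRing A) :=
    Algebra.FormallyEtale.of_isSeparable _ _
  exact Algebra.FormallyEtale.comp S (FractionRing S) (FractionRing A)

/-- By the Leibniz rule `m` and the values of `D` on generators of `A` over `S` suffice. This bounds
the denominators of a derivation into `Frac A`, which is itself too large for Krull's theorem. -/
theorem Derivation.exists_fg_range_le_of_finite {K S A M : Type*} [CommRing K] [CommRing S]
    [CommRing A] [AddCommGroup M] [Algebra K S] [Algebra K A] [Algebra S A] [IsScalarTower K S A]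
    [Module K M] [Module S M] [Module A M] [IsScalarTower S A M] [Module.Finite S A]
    (D : Derivation K A M) (m : M) (hm : ∀ s, ∃ a : A, D (algebraMap S A s) = a • m) :
    ∃ Q : Submodule A M, Q.FG ∧ ∀ a, D a ∈ Q := by
  classical
  obtain ⟨t, ht⟩ := Module.Finite.fg_top (R := S) (M := A)
  let Q : Submodule A M := Submodule.span A ((insert m (t.image D) : Finset M) : Set M)
  refine ⟨Q, ⟨_, rfl⟩, fun a => ?_⟩
  have ha : a ∈ Submodule.span S (t : Set A) := by rw [ht]; trivial
  have hmQ : m ∈ Q := Submodule.subset_span (by simp)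
  induction ha using Submodule.span_induction with
  | mem x hx =>
    exact Submodule.subset_span (by
      simp only [Finset.coe_insert, Finset.coe_image]
      exact Or.inr ⟨x, hx, rfl⟩)
  | zero => simp
  | add x y _ _ hx hy => rw [map_add]; exact Q.add_mem hx hy
  | smul s x _ hx =>
    rw [Algebra.smul_def, Derivation.leibniz]
    obtain ⟨b, hb⟩ := hm s
    rw [hb]
    exact Q.add_mem (Q.smul_mem _ hx) (Q.smul_mem _ (Q.smul_mem _ hmQ))

/-- A derivation whose values lie in a finitely generated submodule is determined by its values
modulo each power of an ideal contained in the Jacobson radical. -/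
theorem Derivation.eq_zero_of_forall_exists_sub_mem_pow {K R M : Type*} [CommRing K] [CommRing R]
    [IsNoetherianRing R] [IsLocalRing R] [AddCommGroup M] [Algebra K R] [Module K M] [Module R M]
    (E : Derivation K R M) (Q : Submodule R M) (hQ : Q.FG) (hE : ∀ g, E g ∈ Q)
    (I : Ideal R) (hI : I ≠ ⊤) (h : ∀ (g : R) (N : ℕ), ∃ p, E p = 0 ∧ g - p ∈ I ^ N) :
    E = 0 := by
  -- By the Leibniz rule a derivation lowers the `I`-adic order by at most one; Krull's intersection
  -- theorem in `Q` then finishes.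
  have hpow : ∀ N : ℕ, ∀ g ∈ I ^ (N + 1), E g ∈ I ^ N • Q := by
    intro N
    induction N with
    | zero => intro g _; simpa using hE g
    | succ N ih =>
      intro g hg
      rw [pow_succ'] at hg
      induction hg using Submodule.mul_induction_on' with
      | mem_mul_mem x hx y hy =>
        rw [Derivation.leibniz]
        refine Submodule.add_mem _ ?_ (Submodule.smul_mem_smul hy (hE x))
        rw [pow_succ', Submodule.mul_smul]
        exact Submodule.smul_mem_smul hx (ih y hy)
      | add x _ y _ hx hy => rw [map_add]; exact Submodule.add_mem _ hx hy
  have : Module.Finite R Q := Module.Finite.iff_fg.mpr hQ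
  have hbot := Ideal.iInf_pow_smul_eq_bot_of_isLocalRing (M := Q) I hI
  ext g
  have hmem : (⟨E g, hE g⟩ : Q) ∈ ⨅ N, I ^ N • (⊤ : Submodule R Q) := by
    rw [Submodule.mem_iInf]
    intro N
    obtain ⟨p, hp, hgp⟩ := h g (N + 1)
    have h1 : E g ∈ I ^ N • Q := by
      have := hpow N _ hgp
      rwa [map_sub, hp, sub_zero] at this
    have h2 : I ^ N • Q = Submodule.map Q.subtype (I ^ N • (⊤ : Submodule R Q)) := by
      rw [Submodule.map_smul'', Submodule.map_top, Submodule.range_subtype]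
    rw [h2] at h1
    obtain ⟨y, hy, hyg⟩ := h1
    have : y = ⟨E g, hE g⟩ := Subtype.ext hyg
    rwa [← this]
  rw [hbot, Submodule.mem_bot] at hmem
  simpa using congrArg Subtype.val hmem

/-! ### Powers of the maximal ideal and vanishing of low coefficients -/

namespace MvPowerSeries

variable {K : Type*} [Field K] {n : ℕ}

/-- The `i`-th summand of the division of a power series by the variables: the part of `g` in which
`X i` is the first variable occurring, divided by `X i`. -/
noncomputable def divX (i : Fin n) (g : MvPowerSeries (Fin n) K) : MvPowerSeries (Fin n) K :=
  fun α => if ∀ j < i, α j = 0 then coeff (α + Finsupp.single i 1) g else 0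

theorem coeff_divX (i : Fin n) (g : MvPowerSeries (Fin n) K) (α : Fin n →₀ ℕ) :
    coeff α (divX i g) = if ∀ j < i, α j = 0 then coeff (α + Finsupp.single i 1) g else 0 :=
  rfl

theorem sum_X_mul_divX (g : MvPowerSeries (Fin n) K) (hg : coeff 0 g = 0) :
    ∑ i, X i * divX i g = g := by
  classical
  ext β
  simp only [map_sum, X, coeff_monomial_mul, one_mul, coeff_divX]
  by_cases hβ : β = 0
  · subst hβ
    rw [hg]
    refine Finset.sum_eq_zero fun i _ => if_neg fun h => ?_
    have := h i
    simp at this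
  · have hne : β.support.Nonempty := Finsupp.support_nonempty_iff.mpr hβ
    set i₀ := β.support.min' hne with hi₀
    have hi₀β : β i₀ ≠ 0 := Finsupp.mem_support_iff.mp (Finset.min'_mem _ hne)
    have hmin : ∀ j < i₀, β j = 0 := fun j hj => by
      by_contra hc
      exact absurd (Finset.min'_le _ j (Finsupp.mem_support_iff.mpr hc)) (not_le.mpr hj)
    have hle : ∀ i, Finsupp.single i 1 ≤ β ↔ β i ≠ 0 := fun i => by
      rw [Finsupp.single_le_iff, Nat.one_le_iff_ne_zero]
    rw [Finset.sum_eq_single i₀]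
    · rw [if_pos ((hle _).mpr hi₀β), if_pos, tsub_add_cancel_of_le ((hle _).mpr hi₀β)]
      intro j hj
      simp [hmin j hj]
    · intro i _ hi
      by_cases hiβ : β i = 0
      · exact if_neg fun h => (hle i).mp h hiβ
      · rw [if_pos ((hle i).mpr hiβ), if_neg]
        intro h
        have hlt : i₀ < i := lt_of_le_of_ne
          (Finset.min'_le _ i (Finsupp.mem_support_iff.mpr hiβ)) (Ne.symm hi)
        have := h i₀ hlt
        rw [Finsupp.tsub_apply, Finsupp.single_eq_of_ne hi.symm] at this
        exact hi₀β (by simpa using this)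
    · simp

theorem coeff_divX_eq_zero {N : ℕ} {g : MvPowerSeries (Fin n) K}
    (hg : ∀ α, Finsupp.degree α < N + 1 → coeff α g = 0) (i : Fin n) (α : Fin n →₀ ℕ)
    (hα : Finsupp.degree α < N) : coeff α (divX i g) = 0 := by
  rw [coeff_divX]
  split_ifs
  · exact hg _ (by simpa [map_add] using hα)
  · rfl

variable (K n) in
/-- The maximal ideal of `K⟦x₁, …, xₙ⟧`, presented by its generators. -/
noncomputable def idealX : Ideal (MvPowerSeries (Fin n) K) :=
  Ideal.span (Set.range X)

theorem mem_idealX_pow_of_coeff_eq_zero {N : ℕ} {g : MvPowerSeries (Fin n) K}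
    (hg : ∀ α, Finsupp.degree α < N → coeff α g = 0) : g ∈ idealX K n ^ N := by
  induction N generalizing g with
  | zero => simp
  | succ N ih =>
    rw [← sum_X_mul_divX g (hg 0 (by simp)), pow_succ']
    exact Ideal.sum_mem _ fun i _ => Ideal.mul_mem_mul (Ideal.subset_span ⟨i, rfl⟩)
      (ih fun α hα => coeff_divX_eq_zero hg i α hα)

theorem constantCoeff_of_mem_idealX {g : MvPowerSeries (Fin n) K} (hg : g ∈ idealX K n) :
    constantCoeff g = 0 := by
  have : idealX K n ≤ RingHom.ker (constantCoeff (σ := Fin n) (R := K)) :=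
    Ideal.span_le.mpr (by rintro _ ⟨i, rfl⟩; simp)
  exact this hg

theorem idealX_ne_top : idealX K n ≠ ⊤ := fun h => by
  have : constantCoeff (1 : MvPowerSeries (Fin n) K) = 0 :=
    constantCoeff_of_mem_idealX (h ▸ trivial)
  simp at this

theorem sub_sum_monomial_mem_idealX_pow (N : ℕ)
    [Fintype {α : Fin n →₀ ℕ | Finsupp.degree α < N}] (g : MvPowerSeries (Fin n) K) :
    g - ∑ α : {α : Fin n →₀ ℕ | Finsupp.degree α < N}, monomial (α : Fin n →₀ ℕ) (coeff α g) ∈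
      idealX K n ^ N := by
  classical
  refine mem_idealX_pow_of_coeff_eq_zero fun β hβ => ?_
  rw [map_sub, map_sum, Finset.sum_eq_single ⟨β, hβ⟩, coeff_monomial_same, sub_self]
  · intro α _ hα
    exact coeff_monomial_ne (fun h => hα (Subtype.ext h.symm)) _
  · simp

theorem sub_truncTotal_mem_idealX_pow (N : ℕ) (g : MvPowerSeries (Fin n) K) :
    g - (truncTotal N g : MvPolynomial (Fin n) K) ∈ idealX K n ^ N := by
  refine mem_idealX_pow_of_coeff_eq_zero fun α hα => ?_
  rw [map_sub, MvPolynomial.coeff_coe, coeff_truncTotal _ hα, sub_self]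

/-- The coefficients of degree less than `N`. -/
noncomputable def lowCoeff (N : ℕ) :
    MvPowerSeries (Fin n) K →ₗ[K] ({α : Fin n →₀ ℕ | Finsupp.degree α < N} → K) :=
  LinearMap.pi fun α => coeff (α : Fin n →₀ ℕ)

theorem coeff_eq_zero_of_lowCoeff {N : ℕ} {g : MvPowerSeries (Fin n) K} (hg : lowCoeff N g = 0)
    (α : Fin n →₀ ℕ) (hα : Finsupp.degree α < N) : coeff α g = 0 :=
  congrFun hg ⟨α, hα⟩

end MvPowerSeries

theorem Ideal.finite_quotient_of_ker_le {K B V : Type*} [Field K] [CommRing B] [Algebra K B]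
    [AddCommGroup V] [Module K V] [Module.Finite K V] (φ : B →ₗ[K] V) (I : Ideal B)
    (h : ∀ b, φ b = 0 → b ∈ I) : Module.Finite K (B ⧸ I) := by
  have : Module.Finite K (B ⧸ LinearMap.ker φ) :=
    Module.Finite.equiv φ.quotKerEquivRange.symm
  let ψ : (B ⧸ LinearMap.ker φ) →ₗ[K] (B ⧸ I) :=
    (LinearMap.ker φ).liftQ (Ideal.Quotient.mkₐ K I).toLinearMap fun b hb =>
      Ideal.Quotient.eq_zero_iff_mem.mpr (h b hb)
  refine Module.Finite.of_surjective ψ fun y => ?_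
  obtain ⟨b, rfl⟩ := Ideal.Quotient.mk_surjective y
  exact ⟨Submodule.Quotient.mk b, rfl⟩

/-! ### Finiteness over `K⟦X⟧` by complete Nakayama -/

namespace PowerSeries

instance isPrecomplete_pi (K ι : Type*) [Field K] :
    IsPrecomplete (Ideal.span {(X : PowerSeries K)}) (ι → PowerSeries K) where
  prec' f hf := by
    have key : ∀ (m : ℕ) (u w : ι → PowerSeries K),
        u ≡ w [SMOD (Ideal.span {(X : PowerSeries K)} ^ m • ⊤ :
            Submodule (PowerSeries K) (ι → PowerSeries K))] ↔
          ∀ i, ∀ d < m, coeff d (u i) = coeff d (w i) := by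
      intro m u w
      rw [SModEq.sub_mem, Ideal.span_singleton_pow, Submodule.ideal_span_singleton_smul,
        Submodule.mem_smul_pointwise_iff_exists]
      constructor
      · rintro ⟨b, -, hb⟩ i d hd
        have hi : X ^ m ∣ u i - w i := ⟨b i, (congrFun hb i).symm⟩
        rw [X_pow_dvd_iff] at hi
        simpa [sub_eq_zero] using hi d hd
      · intro h
        have hdvd : ∀ i, X ^ m ∣ u i - w i := fun i => X_pow_dvd_iff.mpr fun d hd => by
          rw [map_sub, h i d hd, sub_self]
        choose b hb using hdvd
        exact ⟨b, trivial, funext fun i => (hb i).symm⟩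
    -- Coefficient `d` is stable from index `d + 1` on, since congruence modulo `X ^ m` controls the
    -- coefficients below `m`.
    refine ⟨fun i => mk fun d => coeff d (f (d + 1) i), fun m => (key _ _ _).mpr fun i d hd => ?_⟩
    rw [coeff_mk]
    exact ((key _ _ _).mp (hf (Nat.succ_le_of_lt hd)) i d (Nat.lt_succ_self d)).symm

/-- A module over `K⟦X⟧` that is `X`-adically separated and finite-dimensional modulo `X` is
finitely generated. -/
theorem finite_of_finite_quotient {K M : Type*} [Field K] [AddCommGroup M]
    [Module (PowerSeries K) M] [IsHausdorff (Ideal.span {(X : PowerSeries K)}) M]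
    {ι : Type*} [Fintype ι] (e : ι → M)
    (he : ∀ y : M, ∃ (c : ι → K) (z : M), y = ∑ i, C (c i) • e i + (X : PowerSeries K) • z) :
    Module.Finite (PowerSeries K) M := by
  let φ : (ι → PowerSeries K) →ₗ[PowerSeries K] M := Fintype.linearCombination (PowerSeries K) e
  -- The source is `X`-adically precomplete and the target separated, so surjectivity modulo `X`
  -- suffices, with no prior finiteness of `M`.
  refine Module.Finite.of_surjective φ
    (surjective_of_mkQ_comp_surjective (I := Ideal.span {(X : PowerSeries K)}) fun y => ?_)
  obtain ⟨y, rfl⟩ := Submodule.Quotient.mk_surjective _ y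
  obtain ⟨c, z, hy⟩ := he y
  refine ⟨fun i => C (c i), ?_⟩
  have hφ : φ (fun i => C (c i)) = ∑ i, C (c i) • e i := Fintype.linearCombination_apply _ _ _
  rw [LinearMap.comp_apply, Submodule.mkQ_apply, Submodule.Quotient.eq, hy, hφ,
    sub_add_cancel_left]
  exact Submodule.neg_mem _ (Submodule.smul_mem_smul (Ideal.mem_span_singleton_self _) trivial)

end PowerSeries

/-! ### The formal case: `f` lies in the radical of its Jacobian ideal -/

namespace MvPowerSeries

variable {K : Type*} [Field K] {n : ℕ}

/-- The values `E g` of a derivation annihilating the variables vanish, given that they lie in a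
finitely generated submodule. -/
theorem derivation_eq_zero_of_forall_X {M : Type*} [AddCommGroup M] [Module K M]
    [Module (MvPowerSeries (Fin n) K) M] [IsScalarTower K (MvPowerSeries (Fin n) K) M]
    (E : Derivation K (MvPowerSeries (Fin n) K) M)
    (hX : ∀ i, E (X i) = 0) (Q : Submodule (MvPowerSeries (Fin n) K) M) (hQ : Q.FG)
    (hE : ∀ g, E g ∈ Q) : E = 0 := by
  -- Truncations are polynomials, which `E` annihilates.
  refine E.eq_zero_of_forall_exists_sub_mem_pow Q hQ hE (idealX K n) idealX_ne_top fun g N =>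
    ⟨(truncTotal N g : MvPolynomial (Fin n) K), ?_, sub_truncTotal_mem_idealX_pow N g⟩
  induction truncTotal N g using MvPolynomial.induction_on with
  | C a =>
    rw [MvPolynomial.coe_C]
    exact E.map_algebraMap a
  | add p q hp hq => rw [MvPolynomial.coe_add, map_add, hp, hq, add_zero]
  | mul_X p i hp => rw [MvPolynomial.coe_mul, MvPolynomial.coe_X, E.leibniz, hX, hp]; simp

/-- If `P` is a prime containing the partial derivatives of `f` such that `f` is a parameter
modulo `P`, then `f ∈ P`. -/
theorem mem_of_isPrime_of_pderiv_mem [CharZero K] (f : MvPowerSeries (Fin n) K)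
    (hf : constantCoeff f = 0) (P : Ideal (MvPowerSeries (Fin n) K)) [hP : P.IsPrime]
    (hJ : ∀ i, pderiv K i f ∈ P) {k : ℕ} (hk : idealX K n ^ k ≤ P ⊔ Ideal.span {f}) :
    f ∈ P := by
  classical
  by_contra hfP
  let A := MvPowerSeries (Fin n) K ⧸ P
  let π : MvPowerSeries (Fin n) K →ₐ[K] A := Ideal.Quotient.mkₐ K P
  have hπ : Function.Surjective π := Ideal.Quotient.mk_surjective
  have hs : PowerSeries.HasSubst f := PowerSeries.HasSubst.of_constantCoeff_zero hf
  let φ : PowerSeries K →ₐ[K] A := π.comp (PowerSeries.substAlgHom hs)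
  have hφX : φ PowerSeries.X = π f := by
    change π (PowerSeries.substAlgHom hs PowerSeries.X) = _
    rw [PowerSeries.substAlgHom_X]
  have hπf : π f ≠ 0 := fun h => hfP (Ideal.Quotient.eq_zero_iff_mem.mp h)
  let algA : Algebra (PowerSeries K) A := φ.toRingHom.toAlgebra
  have hmap : ∀ s : PowerSeries K, algebraMap (PowerSeries K) A s = φ s := fun _ => rfl
  have tower : IsScalarTower K (PowerSeries K) A :=
    IsScalarTower.of_algebraMap_eq fun x => (φ.commutes x).symm
  have hloc : IsLocalRing A := IsLocalRing.of_surjective' π.toRingHom hπ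
  -- Both `P` and `f` lie in the maximal ideal, so `f` is not a unit of `A`; hence `A` is
  -- `f`-adically separated.
  have hne : Ideal.span {π f} ≠ ⊤ := by
    intro h
    rw [Ideal.span_singleton_eq_top] at h
    have h1 : P ⊔ Ideal.span {f} = ⊤ := by
      obtain ⟨b, hb⟩ := h.exists_right_inv
      obtain ⟨b, rfl⟩ := hπ b
      rw [Ideal.eq_top_iff_one]
      have : 1 - f * b ∈ P := by
        rw [← Ideal.Quotient.eq_zero_iff_mem]
        change π (1 - f * b) = 0
        rw [map_sub, map_mul, hb, map_one, sub_self]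
      exact Submodule.mem_sup.mpr ⟨_, this, _,
        Ideal.mul_mem_right b _ (Ideal.mem_span_singleton_self f), sub_add_cancel _ _⟩
    have h2 : P ⊔ Ideal.span {f} ≤ IsLocalRing.maximalIdeal _ := by
      refine sup_le (IsLocalRing.le_maximalIdeal hP.ne_top) ?_
      rw [Ideal.span_singleton_le_iff_mem, IsLocalRing.mem_maximalIdeal, mem_nonunits_iff,
        isUnit_iff_constantCoeff, hf]
      exact not_isUnit_zero
    rw [h1] at h2
    exact (IsLocalRing.maximalIdeal.isMaximal _).ne_top (top_le_iff.mp h2)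
  -- `A` is a finite module over the power series in `f`
  have hhaus : IsHausdorff (Ideal.span {(PowerSeries.X : PowerSeries K)}) A := by
    have h0 : IsHausdorff (Ideal.span {π f}) A := IsHausdorff.of_isLocalRing _ A hne
    refine ⟨fun x hx => h0.haus' x fun m => ?_⟩
    have := hx m
    rw [SModEq.zero, Ideal.span_singleton_pow, Submodule.ideal_span_singleton_smul,
      Submodule.mem_smul_pointwise_iff_exists] at this ⊢
    obtain ⟨b, -, hb⟩ := this
    refine ⟨b, trivial, ?_⟩
    rw [← hb, Algebra.smul_def, hmap, map_pow, hφX, smul_eq_mul]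
  have hfin : Module.Finite (PowerSeries K) A := by
    have : Finite {α : Fin n →₀ ℕ | Finsupp.degree α < k} := Finsupp.finite_of_degree_lt k
    have : Fintype {α : Fin n →₀ ℕ | Finsupp.degree α < k} := Fintype.ofFinite _
    -- The monomials of degree below `k` generate, since `𝔪^k` consists of multiples of `f` modulo
    -- `P`.
    refine PowerSeries.finite_of_finite_quotient
      (fun α : {α : Fin n →₀ ℕ | Finsupp.degree α < k} => π (monomial (α : Fin n →₀ ℕ) 1))
      fun y => ?_
    obtain ⟨g, rfl⟩ := hπ y
    obtain ⟨p, hp, q, hq, hpq⟩ := Submodule.mem_sup.mp (hk (sub_sum_monomial_mem_idealX_pow k g))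
    obtain ⟨z, rfl⟩ := Ideal.mem_span_singleton.mp hq
    refine ⟨fun α => coeff (α : Fin n →₀ ℕ) g, π z, ?_⟩
    have hp0 : π p = 0 := Ideal.Quotient.eq_zero_iff_mem.mpr hp
    have hg := congrArg π (eq_add_of_sub_eq' hpq.symm)
    rw [map_add, map_add, hp0, zero_add, map_mul, map_sum] at hg
    rw [hg, Algebra.smul_def, hmap, hφX]
    congr 1
    refine Finset.sum_congr rfl fun α _ => ?_
    change _ = algebraMap K (PowerSeries K) _ • _
    rw [algebraMap_smul, ← map_smul, ← LinearMap.map_smul, smul_eq_mul, mul_one]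
  -- A nonzero series is a unit times `X ^ m`, and the power `f ^ m` is nonzero in the domain `A`.
  have hinj : Function.Injective (algebraMap (PowerSeries K) A) := by
    rw [injective_iff_map_eq_zero]
    intro s hs0
    by_contra hne0
    obtain ⟨m, u, rfl⟩ :=
      IsDiscreteValuationRing.eq_unit_mul_pow_irreducible hne0 PowerSeries.X_irreducible
    rw [map_mul, map_pow, hmap PowerSeries.X, hφX] at hs0
    exact mul_ne_zero (u.isUnit.map (algebraMap (PowerSeries K) A)).ne_zero (pow_ne_zero m hπf) hs0
  have hfaith : FaithfulSMul (PowerSeries K) A :=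
    (faithfulSMul_iff_algebraMap_injective _ _).mpr hinj
  have hchar : CharZero (PowerSeries K) :=
    charZero_of_injective_algebraMap (algebraMap K (PowerSeries K)).injective
  -- the derivative with respect to `f` on the fraction field of `A`
  have hetale := formallyEtale_fractionRing_of_finite (PowerSeries K) A
  have tower' : IsScalarTower K (PowerSeries K) (FractionRing A) :=
    IsScalarTower.of_algebraMap_eq fun x => by
      rw [IsScalarTower.algebraMap_apply K A (FractionRing A),
        IsScalarTower.algebraMap_apply K (PowerSeries K) A,
        ← IsScalarTower.algebraMap_apply (PowerSeries K) A (FractionRing A)]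
  obtain ⟨D, hD⟩ := Derivation.exists_extension_of_formallyEtale (F := FractionRing A)
    (PowerSeries.derivative K)
  let D₁ : Derivation K A (FractionRing A) := D.compAlgebraMap A
  have hD₁ : ∀ s, D₁ (algebraMap (PowerSeries K) A s) =
      algebraMap A (FractionRing A)
        (algebraMap (PowerSeries K) A (PowerSeries.derivative K s)) := fun s => by
    rw [← IsScalarTower.algebraMap_apply, ← hD, IsScalarTower.algebraMap_apply _ A (FractionRing A)]
    rfl
  -- The witness is `1` because the derivative maps the image of `K⟦t⟧` into `A · 1`.
  obtain ⟨Q, hQ, hD₁Q⟩ := D₁.exists_fg_range_le_of_finite (S := PowerSeries K) 1 fun s =>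
    
    ⟨algebraMap (PowerSeries K) A (PowerSeries.derivative K s), by
      rw [hD₁]; exact Algebra.algebraMap_eq_smul_one _⟩
  let D₂ : Derivation K (MvPowerSeries (Fin n) K) (FractionRing A) :=
    D₁.compAlgebraMap (MvPowerSeries (Fin n) K)
  have hD₂ : ∀ g, D₂ g = D₁ (π g) := fun _ => rfl
  -- The defect of the chain rule `dg/df = ∑ ∂g/∂xᵢ · dxᵢ/df`; it vanishes on the variables and
  -- takes values in `Q`.
  let E : Derivation K (MvPowerSeries (Fin n) K) (FractionRing A) :=
    D₂ - ∑ i, D₂ (X i) • (Algebra.linearMap _ (FractionRing A)).compDer (pderiv K i)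
  have hE : ∀ g, E g = D₂ g - ∑ i, algebraMap A (FractionRing A) (π (pderiv K i g)) * D₂ (X i) :=
    fun g => by
    have hsum : (∑ i, D₂ (X i) • (Algebra.linearMap _ (FractionRing A)).compDer (pderiv K i)) g =
        ∑ i, D₂ (X i) * algebraMap A (FractionRing A) (π (pderiv K i g)) := by
      rw [← Derivation.coeFnAddMonoidHom_apply, map_sum, Finset.sum_apply]
      rfl
    rw [Derivation.sub_apply, hsum]
    simp_rw [mul_comm]
  have hE0 : E = 0 := by
    refine derivation_eq_zero_of_forall_X E (fun j => ?_)
      (Q.restrictScalars (MvPowerSeries (Fin n) K)) ?_ fun g => ?_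
    · rw [hE, Finset.sum_eq_single j]
      · simp
      · intro i _ hi
        rw [pderiv_X_of_ne hi.symm, map_zero, map_zero, zero_mul]
      · simp
    · exact Submodule.FG.restrictScalars_of_surjective hQ hπ
    · rw [hE]
      exact Q.sub_mem (hD₁Q _) (Q.sum_mem fun i _ => by
        rw [← Algebra.smul_def]
        exact Q.smul_mem _ (hD₁Q _))
  -- At `f` the chain rule reads `1 = 0`: the left side is `df/df`, and all `∂f/∂xᵢ` vanish in `A`.
  have hEf := hE f
  rw [hE0, Finset.sum_eq_zero, hD₂, ← hφX, ← hmap, hD₁] at hEf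
  · simp at hEf
  · intro i _
    have : π (pderiv K i f) = 0 := Ideal.Quotient.eq_zero_iff_mem.mpr (hJ i)
    rw [this, map_zero, zero_mul]

/-- Over a field of characteristic zero, if the Tjurina ideal of a formal power series without
constant term contains a power of the maximal ideal, then so does its Jacobian ideal. -/
theorem exists_idealX_pow_le_span_pderiv [CharZero K] (f : MvPowerSeries (Fin n) K)
    (hf : constantCoeff f = 0) {k : ℕ}
    (hk : idealX K n ^ k ≤ Ideal.span (insert f (Set.range fun i => pderiv K i f))) :
    ∃ l, idealX K n ^ l ≤ Ideal.span (Set.range fun i => pderiv K i f) := by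
  set J := Ideal.span (Set.range fun i => pderiv K i f) with hJ
  have hk' : idealX K n ^ k ≤ J ⊔ Ideal.span {f} := by
    rwa [Ideal.span_insert, sup_comm] at hk
  -- The radical is the intersection of the primes above `J`.
  have hfJ : f ∈ J.radical := by
    rw [Ideal.radical_eq_sInf, Submodule.mem_sInf]
    rintro P ⟨hJP, hP⟩
    exact mem_of_isPrime_of_pderiv_mem f hf P (fun i => hJP (Ideal.subset_span ⟨i, rfl⟩))
      (hk'.trans (sup_le_sup_right hJP _))
  have hrad : idealX K n ≤ J.radical := fun x hx => by
    rw [← Ideal.radical_idem]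
    exact ⟨k, sup_le Ideal.le_radical ((Ideal.span_singleton_le_iff_mem _).mpr hfJ)
      (hk' (Ideal.pow_mem_pow hx k))⟩
  exact Ideal.exists_pow_le_of_le_radical_of_fg hrad (IsNoetherian.noetherian _)

end MvPowerSeries

/-! ### Ideals of finite codimension -/

/-- The quotient is Artinian, so its Jacobson radical, which contains the image of `m`, is
nilpotent. -/
theorem Ideal.exists_pow_le_of_finite_quotient {K B : Type*} [Field K] [CommRing B] [Algebra K B]
    {m : Ideal B} (hm : m ≤ (⊥ : Ideal B).jacobson) (I : Ideal B) [Module.Finite K (B ⧸ I)] :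
    ∃ k, m ^ k ≤ I := by
  have hart : IsArtinianRing (B ⧸ I) := IsArtinianRing.of_finite K _
  obtain ⟨k, hk⟩ := IsArtinianRing.isNilpotent_jacobson_bot (R := B ⧸ I)
  refine ⟨k, ?_⟩
  have hle : m.map (Ideal.Quotient.mk I) ≤ (⊥ : Ideal (B ⧸ I)).jacobson := by
    rw [Ideal.map_le_iff_le_comap]
    intro x hx
    rw [Ideal.mem_comap, Ideal.mem_jacobson_bot]
    intro y
    obtain ⟨y, rfl⟩ := Ideal.Quotient.mk_surjective y
    simpa using (Ideal.mem_jacobson_bot.mp (hm hx) y).map (Ideal.Quotient.mk I)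
  have h0 : (m ^ k).map (Ideal.Quotient.mk I) ≤ ⊥ := by
    rw [Ideal.map_pow, ← Ideal.zero_eq_bot, ← hk]
    exact Ideal.pow_right_mono hle k
  rwa [Ideal.map_le_iff_le_comap, ← RingHom.ker_eq_comap_bot, Ideal.mk_ker] at h0

theorem Ideal.toENat_rank_quotient_lt_top_iff {K B : Type*} [Field K] [CommRing B] [Algebra K B]
    (I : Ideal B) : Cardinal.toENat (Module.rank K (B ⧸ I)) < ⊤ ↔ Module.Finite K (B ⧸ I) := by
  rw [Cardinal.toENat_lt_top, Module.rank_lt_aleph0_iff]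

/-! ### Division, units and descent in `K{x}` -/

namespace AnalyticSeries

open MvPowerSeries

variable {K : Type*} [Field K] {v : AbsoluteValue K ℝ} {n : ℕ}

theorem prod_pow_add_single (ε : Fin n → ℝ) (α : Fin n →₀ ℕ) (i : Fin n) :
    ∏ j, ε j ^ (α + Finsupp.single i 1 : Fin n →₀ ℕ) j = (∏ j, ε j ^ α j) * ε i := by
  classical
  simp_rw [Finsupp.add_apply, pow_add, Finset.prod_mul_distrib]
  congr 1
  rw [Finset.prod_eq_single i]
  · simp
  · intro j _ hj
    rw [Finsupp.single_eq_of_ne hj, pow_zero]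
  · simp

theorem prod_pow_nonneg {ε : Fin n → ℝ} (hε : ∀ i, 0 < ε i) (α : Fin n →₀ ℕ) :
    0 ≤ ∏ j, ε j ^ α j :=
  Finset.prod_nonneg fun j _ => pow_nonneg (hε j).le _

/-- Each coefficient of the quotient is zero or a shifted coefficient of `g`, so the norm grows by
at most the factor `1 / ε i`. -/
theorem IsConvergent.divX {g : MvPowerSeries (Fin n) K} (hg : IsConvergent v g) (i : Fin n) :
    IsConvergent v (MvPowerSeries.divX i g) := by
  obtain ⟨ε, hε, hg⟩ := hg
  refine ⟨ε, hε, ?_⟩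
  calc wnorm v ε (MvPowerSeries.divX i g)
      ≤ ∑' α : Fin n →₀ ℕ, ENNReal.ofReal (ε i)⁻¹ *
          ENNReal.ofReal (v (coeff (α + Finsupp.single i 1) g) *
            ∏ j, ε j ^ (α + Finsupp.single i 1 : Fin n →₀ ℕ) j) := by
        refine ENNReal.tsum_le_tsum fun α => ?_
        rw [← ENNReal.ofReal_mul (inv_nonneg.mpr (hε i).le)]
        refine ENNReal.ofReal_le_ofReal ?_
        have h : (ε i)⁻¹ * (v (coeff (α + Finsupp.single i 1) g) *
            ∏ j, ε j ^ (α + Finsupp.single i 1 : Fin n →₀ ℕ) j) =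
            v (coeff (α + Finsupp.single i 1) g) * ∏ j, ε j ^ α j := by
          rw [prod_pow_add_single]
          have := (hε i).ne'
          field_simp
        rw [h, coeff_divX]
        refine mul_le_mul_of_nonneg_right ?_ (prod_pow_nonneg hε α)
        split_ifs
        · exact le_rfl
        · rw [v.map_zero]; exact v.nonneg _
    _ = ENNReal.ofReal (ε i)⁻¹ * ∑' α : Fin n →₀ ℕ,
          ENNReal.ofReal (v (coeff (α + Finsupp.single i 1) g) *
            ∏ j, ε j ^ (α + Finsupp.single i 1 : Fin n →₀ ℕ) j) := ENNReal.tsum_mul_left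
    _ ≤ ENNReal.ofReal (ε i)⁻¹ * wnorm v ε g := by
        gcongr
        exact ENNReal.tsum_comp_le_tsum_of_injective
          (f := fun α : Fin n →₀ ℕ => (α + Finsupp.single i 1 : Fin n →₀ ℕ))
          (add_left_injective _)
          (fun α : Fin n →₀ ℕ => ENNReal.ofReal (v (coeff α g) * ∏ j, ε j ^ α j))
    _ < ∞ := ENNReal.mul_lt_top ENNReal.ofReal_lt_top hg

/-- The formal division by the variables stays inside `K{x}`, so the order of vanishing controls
membership in powers of `𝔪` there too. -/
theorem mem_maxIdeal_pow_of_coeff_eq_zero {N : ℕ} {g : convSeries v n}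
    (hg : ∀ α, Finsupp.degree α < N → coeff α (g : MvPowerSeries (Fin n) K) = 0) :
    g ∈ maxIdeal v n ^ N := by
  induction N generalizing g with
  | zero => simp
  | succ N ih =>
    let d : Fin n → convSeries v n := fun i =>
      ⟨MvPowerSeries.divX i g, IsConvergent.divX g.2 i⟩
    have h : g = ∑ i, coord v i * d i := by
      refine Subtype.ext ?_
      rw [AddSubmonoidClass.coe_finsetSum]
      exact (sum_X_mul_divX (g : MvPowerSeries (Fin n) K) (hg 0 (by simp))).symm
    rw [h, pow_succ']
    exact Ideal.sum_mem _ fun i _ => Ideal.mul_mem_mul (Ideal.subset_span ⟨i, rfl⟩)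
      (ih fun α hα => coeff_divX_eq_zero hg i α hα)

theorem map_maxIdeal : (maxIdeal v n).map (convSeries v n).val = idealX K n := by
  rw [maxIdeal, Ideal.map_span, ← Set.range_comp]
  rfl

theorem constantCoeff_of_mem_maxIdeal {g : convSeries v n} (hg : g ∈ maxIdeal v n) :
    constantCoeff (g : MvPowerSeries (Fin n) K) = 0 :=
  constantCoeff_of_mem_idealX (map_maxIdeal (v := v) ▸ Ideal.mem_map_of_mem _ hg)

theorem isConvergent_coe (p : MvPolynomial (Fin n) K) :
    IsConvergent v (p : MvPowerSeries (Fin n) K) := by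
  change (p : MvPowerSeries (Fin n) K) ∈ convSeries v n
  induction p using MvPolynomial.induction_on with
  | C a => rw [MvPolynomial.coe_C]; exact (convSeries v n).algebraMap_mem a
  | add p q hp hq => rw [MvPolynomial.coe_add]; exact add_mem hp hq
  | mul_X p i hp => rw [MvPolynomial.coe_mul, MvPolynomial.coe_X]; exact mul_mem hp (coord v i).2

theorem exists_wnorm_lt_one {g : MvPowerSeries (Fin n) K} (hg : IsConvergent v g)
    (hg0 : constantCoeff g = 0) : ∃ ε : Fin n → ℝ, (∀ i, 0 < ε i) ∧ wnorm v ε g < 1 := by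
  obtain ⟨ε, hε, hfin⟩ := hg
  set W := (wnorm v ε g).toReal with hW
  have hW0 : 0 ≤ W := ENNReal.toReal_nonneg
  -- Any positive `t ≤ 1` with `t * W < 1` would serve: scaling `ε` by `t` shrinks every nonconstant
  -- term at least by the factor `t`.
  set t : ℝ := 1 / (W + 2) with ht
  have ht0 : 0 < t := by positivity
  have ht1 : t ≤ 1 := by
    rw [ht, div_le_one (by positivity)]
    linarith
  refine ⟨fun i => t * ε i, fun i => mul_pos ht0 (hε i), ?_⟩
  have hle : wnorm v (fun i => t * ε i) g ≤ ENNReal.ofReal t * wnorm v ε g := by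
    unfold wnorm
    rw [← ENNReal.tsum_mul_left]
    refine ENNReal.tsum_le_tsum fun α => ?_
    rw [← ENNReal.ofReal_mul ht0.le]
    refine ENNReal.ofReal_le_ofReal ?_
    by_cases hα : α = 0
    · subst hα
      rw [coeff_zero_eq_constantCoeff_apply, hg0, v.map_zero]
      simp
    · have h1 : ∏ i, (t * ε i) ^ α i = t ^ (∑ i, α i) * ∏ i, ε i ^ α i := by
        simp_rw [mul_pow, Finset.prod_mul_distrib, Finset.prod_pow_eq_pow_sum]
      have hsum : ∑ i, α i ≠ 0 := fun h => hα (Finsupp.ext fun i =>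
        (Finset.sum_eq_zero_iff.mp h) i (Finset.mem_univ i))
      have h2 : t ^ (∑ i, α i) ≤ t := pow_le_of_le_one ht0.le ht1 hsum
      rw [h1]
      calc v (coeff α g) * (t ^ (∑ i, α i) * ∏ i, ε i ^ α i)
          = t ^ (∑ i, α i) * (v (coeff α g) * ∏ i, ε i ^ α i) := by ring
        _ ≤ t * (v (coeff α g) * ∏ i, ε i ^ α i) :=
          mul_le_mul_of_nonneg_right h2 (mul_nonneg (v.nonneg _) (prod_pow_nonneg hε α))
  refine hle.trans_lt ?_
  rw [← ENNReal.ofReal_toReal hfin.ne, ← ENNReal.ofReal_mul ht0.le, ← hW,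
    ENNReal.ofReal_lt_one, ht, one_div, inv_mul_lt_iff₀ (by positivity)]
  linarith

theorem wnorm_one_le (ε : Fin n → ℝ) : wnorm v ε (1 : MvPowerSeries (Fin n) K) ≤ 1 := by
  classical
  unfold wnorm
  rw [tsum_eq_single 0]
  · simp
  · intro α hα
    rw [coeff_one, if_neg hα, v.map_zero, zero_mul, ENNReal.ofReal_zero]

theorem wnorm_geom_sum_le {ε : Fin n → ℝ} (hε : ∀ i, 0 < ε i) (g : MvPowerSeries (Fin n) K)
    (N : ℕ) : wnorm v ε (∑ k ∈ Finset.range N, g ^ k) ≤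
      ∑ k ∈ Finset.range N, wnorm v ε g ^ k := by
  have hpow : ∀ k, wnorm v ε (g ^ k) ≤ wnorm v ε g ^ k := by
    intro k
    induction k with
    | zero => simpa using wnorm_one_le ε
    | succ k ih =>
      rw [pow_succ, pow_succ]
      exact (wnorm_mul_le v hε _ _).trans (mul_le_mul_left ih _)
  induction N with
  | zero => simp [wnorm]
  | succ N ih =>
    rw [Finset.sum_range_succ, Finset.sum_range_succ]
    exact (wnorm_add_le v hε _ _).trans (add_le_add ih (hpow N))

/-- If `g` has no constant term, then `1 - g` is invertible in `K{x}`. -/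
theorem isUnit_one_sub {g : convSeries v n}
    (hg0 : constantCoeff (g : MvPowerSeries (Fin n) K) = 0) : IsUnit (1 - g) := by
  obtain ⟨ε, hε, hlt⟩ := exists_wnorm_lt_one g.2 hg0
  let g' : MvPowerSeries (Fin n) K := Subtype.val g
  have hu : IsUnit (1 - g') := by
    rw [isUnit_iff_constantCoeff, map_sub, hg0]
    simp
  obtain ⟨h, hh⟩ := hu.exists_right_inv
  have hconv : IsConvergent v h := by
    -- The formal inverse is the geometric series in `g'`. Finitely many of its coefficients already
    -- occur in a partial sum, so every finite part of the norm obeys the geometric bound.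
    refine ⟨ε, hε, lt_of_le_of_lt (b := (1 - wnorm v ε g')⁻¹) ?_ ?_⟩
    · unfold wnorm
      rw [ENNReal.tsum_eq_iSup_sum]
      refine iSup_le fun s => ?_
      -- The order of `g' ^ N` is at least `N`, beyond every degree occurring in `s`.
      set N := s.sup Finsupp.degree + 1 with hN
      have hexp : h = ∑ k ∈ Finset.range N, g' ^ k + g' ^ N * h := by
        have hgeom := mul_neg_geom_sum g' N
        linear_combination (∑ k ∈ Finset.range N, g' ^ k) * hh - h * hgeom
      have hcoeff : ∀ α ∈ s, coeff α h = coeff α (∑ k ∈ Finset.range N, g' ^ k) := by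
        intro α hα
        have hlow : coeff α (g' ^ N * h) = 0 := by
          refine coeff_of_lt_order (lt_of_lt_of_le ?_ (le_order_mul))
          refine lt_of_lt_of_le ?_ (le_add_right (le_order_pow_of_constantCoeff_eq_zero N hg0))
          exact_mod_cast Nat.lt_succ_of_le (Finset.le_sup (f := Finsupp.degree) hα)
        conv_lhs => rw [hexp, map_add, hlow, add_zero]
      calc ∑ α ∈ s, ENNReal.ofReal (v (coeff α h) * ∏ i, ε i ^ α i)
          = ∑ α ∈ s, ENNReal.ofReal
              (v (coeff α (∑ k ∈ Finset.range N, g' ^ k)) * ∏ i, ε i ^ α i) :=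
            Finset.sum_congr rfl fun α hα => by rw [hcoeff α hα]
        _ ≤ wnorm v ε (∑ k ∈ Finset.range N, g' ^ k) := ENNReal.sum_le_tsum s
        _ ≤ ∑ k ∈ Finset.range N, wnorm v ε g' ^ k := wnorm_geom_sum_le hε g' N
        _ ≤ ∑' k, wnorm v ε g' ^ k := ENNReal.sum_le_tsum _
        _ = (1 - wnorm v ε g')⁻¹ := ENNReal.tsum_geometric _
    · rw [ENNReal.inv_lt_top]
      exact tsub_pos_of_lt hlt
  exact IsUnit.of_mul_eq_one ⟨h, hconv⟩ (Subtype.ext hh)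

theorem maxIdeal_le_jacobson : maxIdeal v n ≤ (⊥ : Ideal (convSeries v n)).jacobson := by
  intro x hx
  rw [Ideal.mem_jacobson_bot]
  intro y
  have h := isUnit_one_sub (g := -(x * y)) (by
    change constantCoeff (-((x : MvPowerSeries (Fin n) K) * (y : MvPowerSeries (Fin n) K))) = 0
    rw [map_neg, map_mul, constantCoeff_of_mem_maxIdeal hx, zero_mul, neg_zero])
  rwa [sub_neg_eq_add, add_comm] at h

/-- An ideal of `K{x}` has finite codimension only if it contains a power of `𝔪`. -/
theorem exists_maxIdeal_pow_le (I : Ideal (convSeries v n))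
    (h : Module.Finite K (convSeries v n ⧸ I)) : ∃ k, maxIdeal v n ^ k ≤ I :=
  Ideal.exists_pow_le_of_finite_quotient (K := K) (B := convSeries v n) (m := maxIdeal v n)
    (maxIdeal_le_jacobson (v := v) (n := n)) I

/-- An ideal of `K{x}` that contains a power of `𝔪` has finite codimension. -/
theorem finite_quotient_of_maxIdeal_pow_le {N : ℕ} {I : Ideal (convSeries v n)}
    (h : maxIdeal v n ^ N ≤ I) : Module.Finite K (convSeries v n ⧸ I) := by
  have : Finite {α : Fin n →₀ ℕ | Finsupp.degree α < N} := Finsupp.finite_of_degree_lt N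
  exact Ideal.finite_quotient_of_ker_le (lowCoeff N ∘ₗ (convSeries v n).val.toLinearMap) I
    fun b hb => h (mem_maxIdeal_pow_of_coeff_eq_zero (coeff_eq_zero_of_lowCoeff hb))

/-- If the ideal of `K⟦x⟧` generated by `a₁, …, a_m ∈ K{x}` contains `𝔪^l`, then so does the ideal
of `K{x}` that they generate. -/
theorem maxIdeal_pow_le_span_of_idealX_pow_le {ι : Type*} [Fintype ι] (a : ι → convSeries v n)
    {l : ℕ} (h : idealX K n ^ l ≤
      Ideal.span (Set.range fun i => (a i : MvPowerSeries (Fin n) K))) :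
    maxIdeal v n ^ l ≤ Ideal.span (Set.range a) := by
  have hfg : (maxIdeal v n).FG := ⟨(Set.finite_range (coord v)).toFinset, by simp [maxIdeal]⟩
  -- By Nakayama it suffices to represent elements of `𝔪^l` modulo `𝔪^(l+1)`.
  refine Submodule.le_of_le_smul_of_le_jacobson_bot (hfg.pow) maxIdeal_le_jacobson fun g hg => ?_
  have hgX : (g : MvPowerSeries (Fin n) K) ∈ idealX K n ^ l := by
    rw [← map_maxIdeal (v := v), ← Ideal.map_pow]
    exact Ideal.mem_map_of_mem (convSeries v n).val hg
  obtain ⟨c, hc⟩ := Ideal.mem_span_range_iff_exists_fun.mp (h hgX)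
  -- The formal coefficients `c i` need not converge. Truncation below degree `l + 1` makes them
  -- polynomials, at the cost of an error of order at least `l + 1`.
  let p : ι → convSeries v n := fun i =>
    ⟨(truncTotal (l + 1) (c i) : MvPolynomial (Fin n) K), isConvergent_coe _⟩
  have hrem : g - ∑ i, p i * a i ∈ maxIdeal v n ^ (l + 1) := by
    refine mem_maxIdeal_pow_of_coeff_eq_zero fun α hα => ?_
    have h1 : ((g - ∑ i, p i * a i : convSeries v n) : MvPowerSeries (Fin n) K) =
        ∑ i, (c i - (truncTotal (l + 1) (c i) : MvPolynomial (Fin n) K)) *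
          (a i : MvPowerSeries (Fin n) K) := by
      simp_rw [sub_mul, Finset.sum_sub_distrib, hc]
      rw [AddSubgroupClass.coe_sub, AddSubmonoidClass.coe_finsetSum]
      rfl
    rw [h1, map_sum]
    refine Finset.sum_eq_zero fun i _ => ?_
    refine coeff_of_lt_order (lt_of_lt_of_le ?_ (le_trans le_self_add le_order_mul))
    refine lt_of_lt_of_le (b := ((l + 1 : ℕ) : ℕ∞)) (by exact_mod_cast hα)
      (nat_le_order fun β hβ => ?_)
    rw [map_sub, MvPolynomial.coeff_coe, coeff_truncTotal _ hβ, sub_self]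
  refine Submodule.mem_sup.mpr ⟨∑ i, p i * a i, Ideal.sum_mem _ fun i _ =>
    Ideal.mul_mem_left _ _ (Ideal.subset_span ⟨i, rfl⟩), _, ?_, add_sub_cancel _ _⟩
  rwa [smul_eq_mul, ← pow_succ']

theorem milnorNumber_lt_top_iff_tjurinaNumber_lt_top [CharZero K] (f : convSeries v n)
    (hf : f ∈ maxIdeal v n) : milnorNumber f < ⊤ ↔ tjurinaNumber f < ⊤ := by
  refine (jacobianIdeal f).toENat_rank_quotient_lt_top_iff.trans
    (Iff.trans ?_ (tjurinaIdeal f).toENat_rank_quotient_lt_top_iff.symm)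
  constructor
  · intro h
    obtain ⟨k, hk⟩ := exists_maxIdeal_pow_le (jacobianIdeal f) h
    exact finite_quotient_of_maxIdeal_pow_le
      (hk.trans (Ideal.span_mono (Set.subset_insert _ _)))
  · intro h
    obtain ⟨k, hk⟩ := exists_maxIdeal_pow_le (tjurinaIdeal f) h
    -- Extending both ideals to `K⟦x⟧` gives the hypothesis of the formal case.
    have hk' := Ideal.map_mono (f := (convSeries v n).val) hk
    rw [Ideal.map_pow, map_maxIdeal, tjurinaIdeal, Ideal.map_span, Set.image_insert_eq,
      ← Set.range_comp] at hk'
    obtain ⟨l, hl⟩ := MvPowerSeries.exists_idealX_pow_le_span_pderiv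
      (f : MvPowerSeries (Fin n) K) (constantCoeff_of_mem_maxIdeal hf) hk'
    exact finite_quotient_of_maxIdeal_pow_le
      (maxIdeal_pow_le_span_of_idealX_pow_le (fun i => partialDeriv i f) hl)

end AnalyticSeries

theorem theorem1p4 {K : Type*} [Field K] [CharZero K] (v : AbsoluteValue K ℝ) (n : ℕ)
    (f : AnalyticSeries.convSeries v n) (hf : f ∈ AnalyticSeries.maxIdeal v n) :
    AnalyticSeries.milnorNumber f < ⊤ ↔ AnalyticSeries.tjurinaNumber f < ⊤ := by
  exact AnalyticSeries.milnorNumber_lt_top_iff_tjurinaNumber_lt_top f hf
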